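/- Let $\mathcal S,\mathcal A$ be finite sets, $\mathcal P(s'\mid s,a)$ transition probabilities, $\mathcal R:\mathcal S\times\mathcal A\to\mathbb R$ a reward function with $|\mathcal R(s,a)|\le \mathcal R_{max}$ for all $(s,a)$, where $\mathcal R_{max}>0$, $\gamma\in(0,1)$ a discount factor, and $\pi$ a policy with $\pi(a\mid s)>0$ for all $(s,a)$. Suppose that the Markov chain on $\mathcal S\times\mathcal A$ with transition matrix $P((s,a),(s',a'))=\mathcal P(s'\mid s,a)\,\pi(a'\mid s')$ is ergodic (irreducible and aperiodic), let $\eta_\pi$ be its stationary distribution, and let $m>0$, $r\in(0,1)$ be constants of uniform geometric mixing: $$\sup_{s,a} d_{TV}\big(\mathbb P(s_t=\cdot,a_t=\cdot\mid s_0=s,a_0=a),\eta_\pi\big)\le m r^t\qquad (t=0,1,2,\dots),$$ where $d_{TV}$ is total variation distance. For $\epsilon>0$ put $\tau^{\mathrm{mix}}(\epsilon)=\min\{t\in\{0,1,2,\dots\} : m r^t\le\epsilon\}$. Let $\phi:\mathcal S\times\mathcal A\to\mathbb R^N$ be a feature map with linearly independent coordinate functions $\phi_1,\dots,\phi_N$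 and $\|\phi(s,a)\|^2\le 1$ for all $(s,a)$, and write $Q_w(s,a)=w^\top\phi(s,a)$ and $\|f\|_{\eta_\pi}^2=\sum_{s,a}\eta_\pi(s,a)f(s,a)^2$. Let $R>0$ and let $\Theta\subseteq\mathbb R^N$ be a closed convex set with $\|w\|\le R$ for all $w\in\Theta$. Let $w^*\in\Theta$ solve the projected Bellman equation, that is, $Q_{w^*}$ is the projection, with respect to $\|\cdot\|_{\eta_\pi}$, of $\mathbb T^\pi Q_{w^*}$ onto $\{Q_w: w\in\mathbb R^N\}$, where $$(\mathbb T^\pi Q)(s,a)=\mathcal R(s,a)+\gamma\sum_{s',a'}\mathcal P(s'\mid s,a)\,\pi(a'\mid s')\,Q(s',a').$$ Let $(s_k,a_k)_{k\ge0}$ be a Markov chain with transition matrix $P$ and an arbitrary initial distribution (not necessarily the stationary one). Let $K\ge1$, $\alpha=1/\sqrt K$, $w_0\in\Theta$, and let the projected TD(0) iterates be $$w_{k+1}=\mathrm{Proj}_\Theta\Big[w_k+\alpha\big(\mathcal R(s_k,a_k)+\gamma Q_{w_k}(s_{k+1},a_{k+1})-Q_{w_k}(s_k,a_k)\big)\phi(s_k,a_k)\Big],\qquad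 \bar w_K=\frac1K\sum_{k=0}^{K-1}w_k,$$ where $\mathrm{Proj}_\Theta$ is the Euclidean projection onto $\Theta$. Then, with $F=\mathcal R_{max}+2R$, $$\mathbb E\big[\|Q_{w^*}-Q_{\bar w_K}\|_{\eta_\pi}^2\big]\le\frac{\|w^*-w_0\|^2+F^2\big(17+12\,\tau^{\mathrm{mix}}(1/\sqrt K)\big)}{2(1-\gamma)\sqrt K}+\frac{10F^2m}{(1-r)(1-\gamma)K}.$$ -/

import Mathlib

namespace TDZero

/-- A finite Markov decision process: the transition probabilities `trans s a s'` of moving to `s'`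
when action `a` is performed in state `s`, and the reward `reward s a`. -/
structure MDP (S A : Type*) [Fintype S] where
  trans : S → A → S → ℝ
  reward : S → A → ℝ
  trans_nonneg : ∀ s a s', 0 ≤ trans s a s'
  trans_sum : ∀ s a, ∑ s', trans s a s' = 1

/-- A stochastic policy: `prob s a` is the probability of action `a` in state `s`. -/
structure Policy (S A : Type*) [Fintype A] where
  prob : S → A → ℝ
  prob_nonneg : ∀ s a, 0 ≤ prob s a
  prob_sum : ∀ s, ∑ a, prob s a = 1

section Chain

variable {S A : Type*} [Fintype S] [Fintype A]

/-- Transition matrix of the chain of state-action pairs,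
from `(s, a)` to `(s', a')` with probability `trans s a s' * prob s' a'`. -/
def chainMatrix (M : MDP S A) (π : Policy S A) : Matrix (S × A) (S × A) ℝ :=
  Matrix.of fun x y => M.trans x.1 x.2 y.1 * π.prob y.1 y.2

/-- The Bellman operator of the policy `π` with discount factor `γ`. -/
def bellman (M : MDP S A) (π : Policy S A) (γ : ℝ) (Q : S × A → ℝ) : S × A → ℝ :=
  fun x => M.reward x.1 x.2 +
    γ * ∑ s', ∑ a', M.trans x.1 x.2 s' * π.prob s' a' * Q (s', a')

end Chain

section FiniteChain

variable {E : Type*} [Fintype E]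

/-- The greatest common divisor of the return times of every state is one. -/
def IsAperiodic [DecidableEq E] (P : Matrix E E ℝ) : Prop :=
  ∀ x : E, ∀ d : ℕ, (∀ t : ℕ, 0 < t → 0 < (P ^ t) x x → d ∣ t) → d = 1

/-- Ergodicity of a finite chain: irreducible and aperiodic. -/
def IsErgodic [DecidableEq E] (P : Matrix E E ℝ) : Prop :=
  P.IsIrreducible ∧ IsAperiodic P

/-- `η` is a stationary probability distribution of the chain with transition matrix `P`. -/
structure IsStationary (P : Matrix E E ℝ) (η : E → ℝ) : Prop where
  nonneg : ∀ x, 0 ≤ η x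
  sum_eq_one : ∑ x, η x = 1
  stationary : ∀ y, ∑ x, η x * P x y = η y

/-- Total variation distance of two distributions on a finite set. -/
noncomputable def tvDist (p q : E → ℝ) : ℝ :=
  (1 / 2) * ∑ x, |p x - q x|

/-- Uniform geometric mixing with constants `m`, `r`: row `x` of `P ^ t` is the law at time `t`
of the chain started at `x`. -/
def MixesGeometrically [DecidableEq E] (P : Matrix E E ℝ) (η : E → ℝ) (m r : ℝ) : Prop :=
  ∀ (t : ℕ) (x : E), tvDist (fun y => (P ^ t) x y) η ≤ m * r ^ t

/-- The mixing time `min {t | m r ^ t ≤ ε}`. -/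
noncomputable def mixingTime (m r ε : ℝ) : ℕ :=
  sInf {t : ℕ | m * r ^ t ≤ ε}

/-- `X` is a Markov chain with transition matrix `P`, with an arbitrary law of `X 0`. -/
structure IsMarkovChain {Ω : Type*} [MeasurableSpace Ω] (μ : MeasureTheory.Measure Ω)
    (X : ℕ → Ω → E) (P : Matrix E E ℝ) : Prop where
  measurable : ∀ (t : ℕ) (x : E), MeasurableSet {ω | X t ω = x}
  law : ∀ (n : ℕ) (x : ℕ → E),
    μ.real {ω | ∀ t ≤ n, X t ω = x t} =
      μ.real {ω | X 0 ω = x 0} * ∏ t ∈ Finset.range n, P (x t) (x (t + 1))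

/-- The squared `η`-weighted norm of a function on a finite set. -/
def sqNorm (η : E → ℝ) (f : E → ℝ) : ℝ :=
  ∑ x, η x * f x ^ 2

/-- The linear value function `x ↦ wᵀ φ(x)`. -/
noncomputable def linQ {N : ℕ} (φ : E → EuclideanSpace ℝ (Fin N))
    (w : EuclideanSpace ℝ (Fin N)) : E → ℝ :=
  fun x => inner ℝ w (φ x)

end FiniteChain

/-- The nearest point of `Θ` to `x`, for `Θ` nonempty, closed and convex. -/
noncomputable def proj {V : Type*} [NormedAddCommGroup V] (Θ : Set V) (x : V) : V :=
  Classical.epsilon fun p => p ∈ Θ ∧ ∀ y ∈ Θ, ‖x - p‖ ≤ ‖x - y‖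

theorem proj_spec {V : Type*} [NormedAddCommGroup V] [ProperSpace V] {Θ : Set V}
    (hne : Θ.Nonempty) (hcl : IsClosed Θ) (x : V) :
    proj Θ x ∈ Θ ∧ ∀ y ∈ Θ, ‖x - proj Θ x‖ ≤ ‖x - y‖ := by
  have h : ∃ p, p ∈ Θ ∧ ∀ y ∈ Θ, ‖x - p‖ ≤ ‖x - y‖ := by
    obtain ⟨p, hp, hd⟩ := hcl.exists_infDist_eq_dist hne x
    refine ⟨p, hp, fun y hy => ?_⟩
    rw [← dist_eq_norm, ← dist_eq_norm, ← hd]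
    exact Metric.infDist_le_dist_of_mem hy
  exact Classical.epsilon_spec h

section TD

variable {S A : Type*} [Fintype S] [Fintype A] {N : ℕ}

/-- `w` solves the projected Bellman equation `Φ w = Proj (T (Φ w))`: `Φ w` is the best
approximation of `T (Φ w)`, in the `η`-weighted norm, among the functions `Φ v`. -/
def IsProjectedBellmanSolution (M : MDP S A) (π : Policy S A) (γ : ℝ) (η : S × A → ℝ)
    (φ : S × A → EuclideanSpace ℝ (Fin N)) (w : EuclideanSpace ℝ (Fin N)) : Prop :=
  ∀ v : EuclideanSpace ℝ (Fin N),
    sqNorm η (bellman M π γ (linQ φ w) - linQ φ w) ≤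
      sqNorm η (bellman M π γ (linQ φ w) - linQ φ v)

/-- The TD(0) semi-gradient at `w` for the observed transition from `x` to `y`. -/
noncomputable def semiGradient (M : MDP S A) (γ : ℝ) (φ : S × A → EuclideanSpace ℝ (Fin N))
    (x y : S × A) (w : EuclideanSpace ℝ (Fin N)) : EuclideanSpace ℝ (Fin N) :=
  (M.reward x.1 x.2 + γ * linQ φ w y - linQ φ w x) • φ x

/-- The iterates of projected TD(0) with constant step size `α`, started at `w₀`, along the
trajectory `x` of state-action pairs. -/
noncomputable def tdIterate (M : MDP S A) (γ : ℝ) (φ : S × A → EuclideanSpace ℝ (Fin N))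
    (Θ : Set (EuclideanSpace ℝ (Fin N))) (α : ℝ) (w₀ : EuclideanSpace ℝ (Fin N))
    (x : ℕ → S × A) : ℕ → EuclideanSpace ℝ (Fin N)
  | 0 => w₀
  | k + 1 => proj Θ (tdIterate M γ φ Θ α w₀ x k +
      α • semiGradient M γ φ (x k) (x (k + 1)) (tdIterate M γ φ Θ α w₀ x k))

/-- The average of the first `K` iterates `w_0, …, w_{K-1}`. -/
noncomputable def tdAverage (M : MDP S A) (γ : ℝ) (φ : S × A → EuclideanSpace ℝ (Fin N))
    (Θ : Set (EuclideanSpace ℝ (Fin N))) (α : ℝ) (w₀ : EuclideanSpace ℝ (Fin N))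
    (x : ℕ → S × A) (K : ℕ) : EuclideanSpace ℝ (Fin N) :=
  (1 / (K : ℝ)) • ∑ k ∈ Finset.range K, tdIterate M γ φ Θ α w₀ x k

end TD

end TDZero

/-! Fix a point `v ∈ Θ`. Since the projection is nonexpansive, expanding `‖v - w_{k+1}‖²` bounds
`2α⟪G(w_k), v - w_k⟫`, where `G` is the stationary mean of the semi-gradient, by the decrease of
`‖v - w_k‖²`, plus `α²F²`, plus a noise term. When `v = w*` solves the projected Bellman equation,
the residual of `v` is `η`-orthogonal to the features, and as the transition matrix is a
contraction in the `η`-norm, `⟪G(w), v - w⟫ ≥ (1 - γ)‖Q_v - Q_w‖²`. Summing over `k` telescopes,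
and convexity of the square passes to the averaged iterate.

It remains to bound the expected noise, which is not zero because `w_k` depends on the trajectory.
Replacing `w_k` by `w_{k-τ}` costs at most `6F²ατ`, because the noise is Lipschitz in `w` and the
iterates move by at most `αF` per step. After this replacement, the Markov property at time `k - τ`
and geometric mixing bound the expectation by `4F²m r^τ ≤ 4F²α`. For `k < τ` one goes back to time
`0` instead, at the price of the summable term `4F²m r^k`.
-/

namespace TDZero

open MeasureTheory Matrix
open scoped NNReal InnerProductSpace

section FiniteValued

variable {Ω β G : Type*} [MeasurableSpace Ω] {μ : Measure Ω} [IsFiniteMeasure μ]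
  [NormedAddCommGroup G] {T : Ω → β}

theorem integrable_comp_of_finite [Finite β] (hT : ∀ b, MeasurableSet {ω | T ω = b}) (f : β → G) :
    Integrable (fun ω => f (T ω)) μ := by
  let _ : MeasurableSpace β := ⊤
  have hTm : Measurable T := measurable_to_countable' hT
  exact (Integrable.of_finite (μ := μ.map T)).comp_measurable hTm

theorem integral_comp_of_fintype [Fintype β] [NormedSpace ℝ G] [CompleteSpace G]
    (hT : ∀ b, MeasurableSet {ω | T ω = b}) (f : β → G) :
    ∫ ω, f (T ω) ∂μ = ∑ b, μ.real {ω | T ω = b} • f b := by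
  let _ : MeasurableSpace β := ⊤
  have hTm : Measurable T := measurable_to_countable' hT
  rw [← integral_map hTm.aemeasurable StronglyMeasurable.of_discrete.aestronglyMeasurable,
    integral_fintype .of_finite]
  refine Finset.sum_congr rfl fun b _ => ?_
  rw [map_measureReal_apply hTm (measurableSet_singleton b)]
  rfl

end FiniteValued

section MarkovProperty

variable {E Ω G : Type*} [MeasurableSpace Ω] {μ : Measure Ω} [NormedAddCommGroup G]
  {X : ℕ → Ω → E} {P : Matrix E E ℝ}

theorem IsMarkovChain.measurableSet_domRestrict (hX : IsMarkovChain μ X P) (n : ℕ)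
    (p : Set.Iic n → E) : MeasurableSet {ω | (Set.Iic n).domRestrict (X · ω) = p} := by
  simp only [funext_iff, Set.domRestrict_apply, Set.ofPred_forall]
  exact MeasurableSet.iInter fun t => hX.measurable t (p t)

theorem IsMarkovChain.integrable [Finite E] [IsFiniteMeasure μ] (hX : IsMarkovChain μ X P)
    {n : ℕ} {f : (ℕ → E) → G} (hf : DependsOn f (Set.Iic n)) :
    Integrable (fun ω => f (X · ω)) μ := by
  obtain ⟨g, rfl⟩ := dependsOn_iff_exists_comp.1 hf
  exact integrable_comp_of_finite (hX.measurableSet_domRestrict n) g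

theorem IsMarkovChain.measureReal_succ (hX : IsMarkovChain μ X P) (n : ℕ) (x : ℕ → E) (y : E) :
    μ.real {ω | (∀ t ≤ n, X t ω = x t) ∧ X (n + 1) ω = y} =
      μ.real {ω | ∀ t ≤ n, X t ω = x t} * P (x n) y := by
  set z : ℕ → E := Function.update x (n + 1) y
  have hz_le : ∀ t ≤ n, z t = x t := fun t ht => Function.update_of_ne (by omega) _ _
  have hz_succ : z (n + 1) = y := Function.update_self _ _ _
  have hset : {ω | (∀ t ≤ n, X t ω = x t) ∧ X (n + 1) ω = y} =
      {ω | ∀ t ≤ n + 1, X t ω = z t} := by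
    ext ω
    simp only [Set.mem_ofPred_eq, Nat.le_add_one_iff, or_imp, forall_and, forall_eq, hz_succ]
    refine and_congr_left' (forall₂_congr fun t ht => ?_)
    rw [hz_le t ht]
  have hprod : ∏ t ∈ Finset.range n, P (z t) (z (t + 1)) =
      ∏ t ∈ Finset.range n, P (x t) (x (t + 1)) := by
    refine Finset.prod_congr rfl fun t ht => ?_
    have := Finset.mem_range.1 ht
    rw [hz_le t (by omega), hz_le (t + 1) (by omega)]
  rw [hset, hX.law, hX.law, Finset.prod_range_succ, hprod, hz_le 0 n.zero_le, hz_le n le_rfl,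
    hz_succ, mul_assoc]

variable [Fintype E] [NormedSpace ℝ G] [CompleteSpace G] [IsFiniteMeasure μ]

theorem IsMarkovChain.integral_succ (hX : IsMarkovChain μ X P) {n : ℕ}
    {f : (ℕ → E) → E → G} (hf : DependsOn f (Set.Iic n)) :
    ∫ ω, f (X · ω) (X (n + 1) ω) ∂μ = ∫ ω, ∑ y, P (X n ω) y • f (X · ω) y ∂μ := by
  classical
  obtain ⟨g, rfl⟩ := dependsOn_iff_exists_comp.1 hf
  have hmeas : ∀ q : (Set.Iic n → E) × E,
      MeasurableSet {ω | ((Set.Iic n).domRestrict (X · ω), X (n + 1) ω) = q} := fun q => by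
    simp only [Prod.ext_iff]
    exact (hX.measurableSet_domRestrict n q.1).inter (hX.measurable _ _)
  have hlaw : ∀ (p : Set.Iic n → E) (y : E),
      μ.real {ω | ((Set.Iic n).domRestrict (X · ω), X (n + 1) ω) = (p, y)} =
        μ.real {ω | (Set.Iic n).domRestrict (X · ω) = p} * P (p ⟨n, Set.self_mem_Iic⟩) y := by
    intro p y
    have : Nonempty E := ⟨y⟩
    obtain ⟨x, rfl⟩ := Subtype.surjective_restrict (β := fun _ => E) (· ∈ Set.Iic n) p
    simpa [funext_iff] using hX.measureReal_succ n x y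
  calc ∫ ω, g ((Set.Iic n).domRestrict (X · ω)) (X (n + 1) ω) ∂μ
      = ∑ p, ∑ y, μ.real {ω | ((Set.Iic n).domRestrict (X · ω), X (n + 1) ω) = (p, y)} •
          g p y := by
        rw [← Fintype.sum_prod_type', integral_comp_of_fintype hmeas fun q => g q.1 q.2]
    _ = ∑ p, μ.real {ω | (Set.Iic n).domRestrict (X · ω) = p} •
          ∑ y, P (p ⟨n, Set.self_mem_Iic⟩) y • g p y := by
        simp only [hlaw, mul_smul, Finset.smul_sum]
    _ = _ := (integral_comp_of_fintype (hX.measurableSet_domRestrict n)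
        fun p => ∑ y, P (p ⟨n, Set.self_mem_Iic⟩) y • g p y).symm

variable [DecidableEq E]

theorem IsMarkovChain.integral_add (hX : IsMarkovChain μ X P) {n : ℕ} (j : ℕ)
    {f : (ℕ → E) → E → G} (hf : DependsOn f (Set.Iic n)) :
    ∫ ω, f (X · ω) (X (n + j) ω) ∂μ = ∫ ω, ∑ y, (P ^ j) (X n ω) y • f (X · ω) y ∂μ := by
  induction j generalizing f with
  | zero => simp [Matrix.one_apply]
  | succ j ih =>
    have hf' : DependsOn f (Set.Iic (n + j)) := hf.mono (Set.Iic_subset_Iic.2 (by omega))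
    have hPf : DependsOn (fun x z => ∑ y, P z y • f x y) (Set.Iic n) :=
      fun x x' h => by simp only [hf h]
    rw [← add_assoc, hX.integral_succ hf', ih hPf]
    refine integral_congr_ae (.of_forall fun ω => ?_)
    simp only [pow_succ, Matrix.mul_apply, Finset.smul_sum, Finset.sum_smul, smul_smul]
    exact Finset.sum_comm

theorem IsMarkovChain.integral_add_succ (hX : IsMarkovChain μ X P) {n : ℕ} (j : ℕ)
    {f : (ℕ → E) → E → E → G} (hf : DependsOn f (Set.Iic n)) :
    ∫ ω, f (X · ω) (X (n + j) ω) (X (n + j + 1) ω) ∂μ =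
      ∫ ω, ∑ y, (P ^ j) (X n ω) y • ∑ z, P y z • f (X · ω) y z ∂μ := by
  have hf' : DependsOn (fun x => f x (x (n + j))) (Set.Iic (n + j)) := fun x x' h => by
    simp only [hf fun t ht => h t (Set.Iic_subset_Iic.2 (n.le_add_right j) ht),
      h (n + j) Set.self_mem_Iic]
  have hPf : DependsOn (fun x y => ∑ z, P y z • f x y z) (Set.Iic n) :=
    fun x x' h => by simp only [hf h]
  rw [hX.integral_succ hf', hX.integral_add j hPf]

end MarkovProperty

section Projection

variable {V : Type*} [NormedAddCommGroup V] [InnerProductSpace ℝ V] [ProperSpace V] {Θ : Set V}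

theorem inner_sub_proj_sub_proj_nonpos (hcl : IsClosed Θ) (hconv : Convex ℝ Θ) {y : V}
    (hy : y ∈ Θ) (x : V) : ⟪x - proj Θ x, y - proj Θ x⟫_ℝ ≤ 0 := by
  obtain ⟨hmem, hmin⟩ := proj_spec ⟨y, hy⟩ hcl x
  have : Nonempty Θ := ⟨⟨y, hy⟩⟩
  have hinf : ‖x - proj Θ x‖ = ⨅ w : Θ, ‖x - w‖ :=
    le_antisymm (le_ciInf fun w => hmin w w.2)
      (ciInf_le ⟨0, Set.forall_mem_range.2 fun _ => norm_nonneg _⟩ (⟨_, hmem⟩ : Θ))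
  exact (norm_eq_iInf_iff_real_inner_le_zero hconv hmem).1 hinf y hy

theorem norm_sub_proj_le (hcl : IsClosed Θ) (hconv : Convex ℝ Θ) {y : V} (hy : y ∈ Θ) (x : V) :
    ‖y - proj Θ x‖ ≤ ‖y - x‖ := by
  have hin := inner_sub_proj_sub_proj_nonpos hcl hconv hy x
  have hsq := norm_sub_sq_real (y - proj Θ x) (x - proj Θ x)
  rw [sub_sub_sub_cancel_right, real_inner_comm] at hsq
  exact pow_le_pow_iff_left₀ (norm_nonneg _) (norm_nonneg _) two_ne_zero |>.1
    (by linarith [sq_nonneg ‖x - proj Θ x‖])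

end Projection

section StationaryMean

variable {E V : Type*} [Fintype E] [NormedAddCommGroup V]

theorem norm_sum_smul_le_of_forall_norm_le [NormedSpace ℝ V] {p : E → ℝ} (hp : ∀ x, 0 ≤ p x)
    (hp1 : ∑ x, p x = 1) {v : E → V} {C : ℝ} (hv : ∀ x, ‖v x‖ ≤ C) : ‖∑ x, p x • v x‖ ≤ C :=
  mem_closedBall_zero_iff.1 <| (convex_closedBall 0 C).sum_mem (fun x _ => hp x) hp1
    fun x _ => mem_closedBall_zero_iff.2 (hv x)

theorem tvDist_nonneg (p q : E → ℝ) : 0 ≤ tvDist p q := by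
  unfold tvDist
  positivity

theorem norm_sum_smul_sub_sum_smul_le_tvDist [NormedSpace ℝ V] (p q : E → ℝ) {v : E → V} {C : ℝ}
    (hv : ∀ x, ‖v x‖ ≤ C) : ‖∑ x, p x • v x - ∑ x, q x • v x‖ ≤ 2 * tvDist p q * C :=
  calc ‖∑ x, p x • v x - ∑ x, q x • v x‖
      ≤ ∑ x, |p x - q x| * C := by
        simp only [← Finset.sum_sub_distrib, ← sub_smul]
        refine norm_sum_le_of_le _ fun x _ => ?_
        rw [norm_smul, Real.norm_eq_abs]
        exact mul_le_mul_of_nonneg_left (hv x) (abs_nonneg _)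
    _ = 2 * tvDist p q * C := by
        rw [← Finset.sum_mul, tvDist]
        ring

theorem IsStationary.nonempty {P : Matrix E E ℝ} {η : E → ℝ} (hη : IsStationary P η) :
    Nonempty E := by
  by_contra hE
  rw [not_nonempty_iff] at hE
  simpa using hη.sum_eq_one

/-- The mean of `v x y` over a transition from `x` to `y` of the chain with transition matrix `P`
when `x` is distributed according to `η`; used with `η` stationary, hence the name. -/
def stationaryMean [Module ℝ V] (P : Matrix E E ℝ) (η : E → ℝ) (v : E → E → V) : V :=
  ∑ x, η x • ∑ y, P x y • v x y

theorem stationaryMean_sub [Module ℝ V] (P : Matrix E E ℝ) (η : E → ℝ) (u v : E → E → V) :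
    stationaryMean P η (fun x y => u x y - v x y) =
      stationaryMean P η u - stationaryMean P η v := by
  simp only [stationaryMean, smul_sub, Finset.sum_sub_distrib]

theorem inner_stationaryMean [InnerProductSpace ℝ V] (P : Matrix E E ℝ) (η : E → ℝ)
    (v : E → E → V) (d : V) :
    ⟪stationaryMean P η v, d⟫_ℝ = stationaryMean P η fun x y => ⟪v x y, d⟫_ℝ := by
  simp only [stationaryMean, sum_inner, real_inner_smul_left, smul_eq_mul]

variable [DecidableEq E] {P : Matrix E E ℝ} {η : E → ℝ} {m r : ℝ}

theorem stationaryMean_const [Module ℝ V] (hP : P ∈ rowStochastic ℝ E) (hη : ∑ x, η x = 1)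
    (c : V) : stationaryMean P η (fun _ _ => c) = c := by
  simp only [stationaryMean, ← Finset.sum_smul, sum_row_of_mem_rowStochastic hP, hη, one_smul]

theorem norm_stationaryMean_le [NormedSpace ℝ V] (hP : P ∈ rowStochastic ℝ E)
    (hη : IsStationary P η) {v : E → E → V} {C : ℝ} (hv : ∀ x y, ‖v x y‖ ≤ C) :
    ‖stationaryMean P η v‖ ≤ C :=
  norm_sum_smul_le_of_forall_norm_le hη.nonneg hη.sum_eq_one fun x =>
    norm_sum_smul_le_of_forall_norm_le (fun _ => nonneg_of_mem_rowStochastic hP)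
      (sum_row_of_mem_rowStochastic hP x) (hv x)

theorem MixesGeometrically.nonneg (hmix : MixesGeometrically P η m r) (x : E) : 0 ≤ m := by
  simpa only [pow_zero, mul_one] using
    (tvDist_nonneg _ _).trans (hmix 0 x)

theorem MixesGeometrically.norm_sum_pow_smul_sub_stationaryMean_le [NormedSpace ℝ V]
    (hmix : MixesGeometrically P η m r) (hP : P ∈ rowStochastic ℝ E) {v : E → E → V} {C : ℝ}
    (hv : ∀ x y, ‖v x y‖ ≤ C) (t : ℕ) (x : E) :
    ‖∑ y, (P ^ t) x y • ∑ z, P y z • v y z - stationaryMean P η v‖ ≤ 2 * (m * r ^ t) * C := by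
  have hC : 0 ≤ C := (norm_nonneg _).trans (hv x x)
  have hPv : ∀ y, ‖∑ z, P y z • v y z‖ ≤ C := fun y =>
    norm_sum_smul_le_of_forall_norm_le (fun _ => nonneg_of_mem_rowStochastic hP)
      (sum_row_of_mem_rowStochastic hP y) (hv y)
  refine (norm_sum_smul_sub_sum_smul_le_tvDist _ η hPv).trans ?_
  gcongr
  exact hmix t x

theorem IsMarkovChain.norm_integral_le_of_stationaryMean_eq_zero [NormedSpace ℝ V]
    [CompleteSpace V] {Ω : Type*} [MeasurableSpace Ω] {μ : Measure Ω} [IsProbabilityMeasure μ]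
    {X : ℕ → Ω → E} (hX : IsMarkovChain μ X P) (hmix : MixesGeometrically P η m r)
    (hP : P ∈ rowStochastic ℝ E) {n : ℕ} {f : (ℕ → E) → E → E → V}
    (hf : DependsOn f (Set.Iic n)) (hf0 : ∀ x, stationaryMean P η (f x) = 0) {C : ℝ}
    (hC : ∀ x y z, ‖f x y z‖ ≤ C) (j : ℕ) :
    ‖∫ ω, f (X · ω) (X (n + j) ω) (X (n + j + 1) ω) ∂μ‖ ≤ 2 * (m * r ^ j) * C := by
  rw [hX.integral_add_succ j hf]
  refine (norm_integral_le_of_norm_le_const (.of_forall fun ω => ?_)).trans_eq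
    (by rw [probReal_univ, mul_one])
  simpa only [hf0, sub_zero] using
    hmix.norm_sum_pow_smul_sub_stationaryMean_le hP (hC (X · ω)) j (X n ω)

end StationaryMean

section MarkovianNoise

variable {E V : Type*} [Fintype E] [NormedAddCommGroup V] [InnerProductSpace ℝ V]

/-- The mean field `w ↦ 𝔼[g(x, y, w)]` of a stochastic approximation scheme whose updates `g` are
driven by the transitions of a Markov chain, the mean being over a stationary transition. -/
def meanField (P : Matrix E E ℝ) (η : E → ℝ) (g : E → E → V → V) (w : V) : V :=
  stationaryMean P η fun x y => g x y w

/-- The noise of the update `g x y w` with respect to the mean field, in the direction from the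
target `v` to `w`. -/
def fieldNoise (P : Matrix E E ℝ) (η : E → ℝ) (g : E → E → V → V) (v : V) (x y : E) (w : V) : ℝ :=
  ⟪g x y w - meanField P η g w, w - v⟫_ℝ

variable [DecidableEq E] {P : Matrix E E ℝ} {η : E → ℝ} {g : E → E → V → V} {Θ : Set V}
  {v w : V} {F D : ℝ} {L : ℝ≥0}

theorem stationaryMean_fieldNoise (hP : P ∈ rowStochastic ℝ E) (hη : ∑ x, η x = 1) (v w : V) :
    stationaryMean P η (fun x y => fieldNoise P η g v x y w) = 0 := by
  simp only [fieldNoise, ← inner_stationaryMean, stationaryMean_sub, stationaryMean_const hP hη]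
  rw [meanField, sub_self, inner_zero_left]

theorem lipschitzOnWith_meanField (hP : P ∈ rowStochastic ℝ E) (hη : IsStationary P η)
    (hL : ∀ x y, LipschitzOnWith L (g x y) Θ) : LipschitzOnWith L (meanField P η g) Θ := by
  refine .of_dist_le_mul fun w hw u hu => ?_
  rw [dist_eq_norm, dist_eq_norm, meanField, meanField, ← stationaryMean_sub]
  exact norm_stationaryMean_le hP hη fun x y => (hL x y).norm_sub_le hw hu

theorem norm_sub_meanField_le (hP : P ∈ rowStochastic ℝ E) (hη : IsStationary P η)
    (hF : ∀ x y, ‖g x y w‖ ≤ F) (x y : E) : ‖g x y w - meanField P η g w‖ ≤ 2 * F :=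
  (norm_sub_le _ _).trans (by
    rw [two_mul]
    exact add_le_add (hF x y) (norm_stationaryMean_le hP hη hF))

theorem abs_fieldNoise_le (hP : P ∈ rowStochastic ℝ E) (hη : IsStationary P η)
    (hF : ∀ x y, ‖g x y w‖ ≤ F) (hD : ‖w - v‖ ≤ D) (x y : E) :
    |fieldNoise P η g v x y w| ≤ 2 * F * D := by
  have hgF := norm_sub_meanField_le hP hη hF x y
  exact (abs_real_inner_le_norm _ _).trans
    (mul_le_mul hgF hD (norm_nonneg _) ((norm_nonneg _).trans hgF))

theorem fieldNoise_sub_fieldNoise_le (hP : P ∈ rowStochastic ℝ E) (hη : IsStationary P η)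
    (hF : ∀ w ∈ Θ, ∀ x y, ‖g x y w‖ ≤ F) (hL : ∀ x y, LipschitzOnWith L (g x y) Θ)
    (hD : ∀ w ∈ Θ, ‖w - v‖ ≤ D) {u : V} (hw : w ∈ Θ) (hu : u ∈ Θ) (x y : E) :
    fieldNoise P η g v x y w - fieldNoise P η g v x y u ≤ (2 * F + 2 * L * D) * ‖w - u‖ := by
  set G := meanField P η g
  have hsplit : fieldNoise P η g v x y w - fieldNoise P η g v x y u =
      ⟪g x y w - G w, w - u⟫_ℝ + ⟪(g x y w - g x y u) - (G w - G u), u - v⟫_ℝ := by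
    simp only [fieldNoise, inner_sub_left, inner_sub_right, G]
    ring
  have hdiff : ‖(g x y w - g x y u) - (G w - G u)‖ ≤ 2 * L * ‖w - u‖ :=
    (norm_sub_le _ _).trans (by
      linarith [(hL x y).norm_sub_le hw hu,
        (lipschitzOnWith_meanField hP hη hL).norm_sub_le hw hu])
  calc fieldNoise P η g v x y w - fieldNoise P η g v x y u
      ≤ ‖g x y w - G w‖ * ‖w - u‖ + ‖(g x y w - g x y u) - (G w - G u)‖ * ‖u - v‖ := by
        rw [hsplit]
        exact add_le_add (real_inner_le_norm _ _) (real_inner_le_norm _ _)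
    _ ≤ 2 * F * ‖w - u‖ + 2 * L * ‖w - u‖ * D := by
        gcongr
        exacts [norm_sub_meanField_le hP hη (hF w hw) x y, hD u hu]
    _ = (2 * F + 2 * L * D) * ‖w - u‖ := by ring

end MarkovianNoise

section ProjectedIterates

variable {E V : Type*} [NormedAddCommGroup V] [InnerProductSpace ℝ V]

/-- The iterates of projected stochastic approximation with updates `g` and constant step size `α`,
driven by the trajectory `x`; projected TD(0) is the case of the semi-gradient. -/
noncomputable def projIterate (Θ : Set V) (α : ℝ) (g : E → E → V → V) (w₀ : V) (x : ℕ → E) : ℕ → V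
  | 0 => w₀
  | k + 1 => proj Θ (projIterate Θ α g w₀ x k +
      α • g (x k) (x (k + 1)) (projIterate Θ α g w₀ x k))

variable {Θ : Set V} {α F D : ℝ} {L : ℝ≥0} {g : E → E → V → V} {w₀ v : V}

theorem projIterate_congr {x x' : ℕ → E} {k : ℕ} (h : ∀ t ≤ k, x t = x' t) :
    projIterate Θ α g w₀ x k = projIterate Θ α g w₀ x' k := by
  induction k with
  | zero => rfl
  | succ k ih =>
    rw [projIterate, projIterate, ih fun t ht => h t (ht.trans k.le_succ), h k k.le_succ,
      h (k + 1) le_rfl]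

variable [ProperSpace V]

theorem projIterate_mem (hcl : IsClosed Θ) (hw₀ : w₀ ∈ Θ) (x : ℕ → E) (k : ℕ) :
    projIterate Θ α g w₀ x k ∈ Θ := by
  cases k with
  | zero => exact hw₀
  | succ k => exact (proj_spec ⟨w₀, hw₀⟩ hcl _).1

theorem norm_projIterate_succ_sub_le (hcl : IsClosed Θ) (hconv : Convex ℝ Θ) (hw₀ : w₀ ∈ Θ)
    (hα : 0 ≤ α) (hF : ∀ w ∈ Θ, ∀ x y, ‖g x y w‖ ≤ F) (x : ℕ → E) (k : ℕ) :
    ‖projIterate Θ α g w₀ x (k + 1) - projIterate Θ α g w₀ x k‖ ≤ α * F := by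
  have hmem := projIterate_mem (α := α) (g := g) hcl hw₀ x k
  rw [norm_sub_rev]
  refine (norm_sub_proj_le hcl hconv hmem _).trans ?_
  rw [sub_add_cancel_left, norm_neg, norm_smul, Real.norm_of_nonneg hα]
  exact mul_le_mul_of_nonneg_left (hF _ hmem _ _) hα

theorem norm_projIterate_add_sub_le (hcl : IsClosed Θ) (hconv : Convex ℝ Θ) (hw₀ : w₀ ∈ Θ)
    (hα : 0 ≤ α) (hF : ∀ w ∈ Θ, ∀ x y, ‖g x y w‖ ≤ F) (x : ℕ → E) (n j : ℕ) :
    ‖projIterate Θ α g w₀ x (n + j) - projIterate Θ α g w₀ x n‖ ≤ α * F * j := by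
  rw [← dist_eq_norm, dist_comm]
  refine (dist_le_range_sum_of_dist_le (f := fun i => projIterate Θ α g w₀ x (n + i)) j
    (d := fun _ => α * F) fun _ => ?_).trans_eq (by simp [mul_comm])
  rw [dist_comm, dist_eq_norm]
  exact norm_projIterate_succ_sub_le hcl hconv hw₀ hα hF x _

variable [Fintype E] {P : Matrix E E ℝ} {η : E → ℝ}

theorem two_mul_inner_meanField_projIterate_le (hcl : IsClosed Θ) (hconv : Convex ℝ Θ)
    (hw₀ : w₀ ∈ Θ) (hv : v ∈ Θ) (hα : 0 ≤ α) (hF : ∀ w ∈ Θ, ∀ x y, ‖g x y w‖ ≤ F)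
    (x : ℕ → E) (k : ℕ) :
    2 * α * ⟪meanField P η g (projIterate Θ α g w₀ x k), v - projIterate Θ α g w₀ x k⟫_ℝ ≤
      ‖v - projIterate Θ α g w₀ x k‖ ^ 2 - ‖v - projIterate Θ α g w₀ x (k + 1)‖ ^ 2 +
        α ^ 2 * F ^ 2 +
        2 * α * fieldNoise P η g v (x k) (x (k + 1)) (projIterate Θ α g w₀ x k) := by
  set w := projIterate Θ α g w₀ x k
  set u := g (x k) (x (k + 1)) w
  have hstep : ‖v - projIterate Θ α g w₀ x (k + 1)‖ ^ 2 ≤ ‖v - w - α • u‖ ^ 2 := by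
    rw [sub_sub]
    gcongr
    exact norm_sub_proj_le hcl hconv hv _
  have hexpand : ‖v - w - α • u‖ ^ 2 =
      ‖v - w‖ ^ 2 - 2 * α * ⟪u, v - w⟫_ℝ + α ^ 2 * ‖u‖ ^ 2 := by
    rw [norm_sub_sq_real, real_inner_smul_right, real_inner_comm, norm_smul, mul_pow,
      Real.norm_of_nonneg hα]
    ring
  have hbound : α ^ 2 * ‖u‖ ^ 2 ≤ α ^ 2 * F ^ 2 := by
    gcongr
    exact hF w (projIterate_mem hcl hw₀ x k) _ _
  have hnoise : fieldNoise P η g v (x k) (x (k + 1)) w =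
      ⟪meanField P η g w, v - w⟫_ℝ - ⟪u, v - w⟫_ℝ := by
    rw [fieldNoise, ← inner_sub_left, ← neg_sub v w, inner_neg_right, ← inner_neg_left, neg_sub]
  rw [hnoise]
  linarith

theorem two_mul_sum_inner_meanField_projIterate_le (hcl : IsClosed Θ) (hconv : Convex ℝ Θ)
    (hw₀ : w₀ ∈ Θ) (hv : v ∈ Θ) (hα : 0 ≤ α) (hF : ∀ w ∈ Θ, ∀ x y, ‖g x y w‖ ≤ F)
    (x : ℕ → E) (K : ℕ) :
    2 * α * ∑ k ∈ Finset.range K,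
        ⟪meanField P η g (projIterate Θ α g w₀ x k), v - projIterate Θ α g w₀ x k⟫_ℝ ≤
      ‖v - w₀‖ ^ 2 + α ^ 2 * (K * F ^ 2) + 2 * α * ∑ k ∈ Finset.range K,
        fieldNoise P η g v (x k) (x (k + 1)) (projIterate Θ α g w₀ x k) := by
  have hsum := Finset.sum_le_sum fun k (_ : k ∈ Finset.range K) =>
    two_mul_inner_meanField_projIterate_le (P := P) (η := η) hcl hconv hw₀ hv hα hF x k
  simp only [Finset.sum_add_distrib, ← Finset.mul_sum, Finset.sum_const, Finset.card_range,
    nsmul_eq_mul, Finset.sum_range_sub' fun k => ‖v - projIterate Θ α g w₀ x k‖ ^ 2] at hsum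
  refine hsum.trans ?_
  gcongr
  exact sub_le_self _ (sq_nonneg _)

end ProjectedIterates

theorem sum_range_pow_le {r : ℝ} (hr0 : 0 ≤ r) (hr1 : r < 1) (K : ℕ) :
    ∑ k ∈ Finset.range K, r ^ k ≤ 1 / (1 - r) := by
  rw [one_div, ← tsum_geometric_of_lt_one hr0 hr1]
  exact (summable_geometric_of_lt_one hr0 hr1).sum_le_tsum _ fun _ _ => pow_nonneg hr0 _

theorem mul_pow_mixingTime_le {r : ℝ} (hr0 : 0 ≤ r) (hr1 : r < 1) (m : ℝ) {ε : ℝ} (hε : 0 < ε) :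
    m * r ^ mixingTime m r ε ≤ ε := by
  have hlim : Filter.Tendsto (fun t : ℕ => m * r ^ t) Filter.atTop (nhds 0) := by
    simpa only [mul_zero] using (tendsto_pow_atTop_nhds_zero_of_lt_one hr0 hr1).const_mul m
  exact Nat.sInf_mem (s := {t | m * r ^ t ≤ ε}) (hlim.eventually_le_const hε).exists

section ExpectedRegret

variable {E V Ω : Type*} [Fintype E] [NormedAddCommGroup V] [InnerProductSpace ℝ V]
  [MeasurableSpace Ω] {μ : Measure Ω} [IsProbabilityMeasure μ] {X : ℕ → Ω → E} {P : Matrix E E ℝ}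
  {η : E → ℝ} {g : E → E → V → V} {Θ : Set V} {α F D m r : ℝ} {L : ℝ≥0} {w₀ v : V}

theorem integrable_fieldNoise (hX : IsMarkovChain μ X P) (n j : ℕ) :
    Integrable (fun ω => fieldNoise P η g v (X (n + j) ω) (X (n + j + 1) ω)
      (projIterate Θ α g w₀ (X · ω) n)) μ :=
  hX.integrable (n := n + j + 1) (f := fun x => fieldNoise P η g v (x (n + j)) (x (n + j + 1))
    (projIterate Θ α g w₀ x n)) fun x x' h => by
      have hn : ∀ t ≤ n, x t = x' t := fun t ht => h t (Set.mem_Iic.2 (by omega))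
      simp only [projIterate_congr hn, h (n + j) (Nat.le_succ _), h (n + j + 1) Set.self_mem_Iic]

theorem integrable_sum_inner_meanField (hX : IsMarkovChain μ X P) (K : ℕ) :
    Integrable (fun ω => ∑ k ∈ Finset.range K, ⟪meanField P η g (projIterate Θ α g w₀ (X · ω) k),
      v - projIterate Θ α g w₀ (X · ω) k⟫_ℝ) μ :=
  integrable_finsetSum _ fun k _ => hX.integrable (n := k) (f := fun x => ⟪meanField P η g
    (projIterate Θ α g w₀ x k), v - projIterate Θ α g w₀ x k⟫_ℝ) fun x x' h => by
      simp only [projIterate_congr h]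

variable [DecidableEq E] [ProperSpace V]

theorem integral_fieldNoise_delayed_le (hX : IsMarkovChain μ X P) (hP : P ∈ rowStochastic ℝ E)
    (hη : IsStationary P η) (hmix : MixesGeometrically P η m r) (hcl : IsClosed Θ) (hw₀ : w₀ ∈ Θ)
    (hF : ∀ w ∈ Θ, ∀ x y, ‖g x y w‖ ≤ F) (hD : ∀ w ∈ Θ, ‖w - v‖ ≤ D) (n j : ℕ) :
    ∫ ω, fieldNoise P η g v (X (n + j) ω) (X (n + j + 1) ω)
        (projIterate Θ α g w₀ (X · ω) n) ∂μ ≤ 4 * F * D * (m * r ^ j) := by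
  have hmem (x : ℕ → E) : projIterate Θ α g w₀ x n ∈ Θ := projIterate_mem hcl hw₀ x n
  have hdep : DependsOn (fun x y z => fieldNoise P η g v y z (projIterate Θ α g w₀ x n))
      (Set.Iic n) := fun x x' h => by
    simp only [projIterate_congr h]
  refine (le_abs_self _).trans ((hX.norm_integral_le_of_stationaryMean_eq_zero hmix hP hdep
    (fun x => stationaryMean_fieldNoise hP hη.sum_eq_one v _)
    (fun x => abs_fieldNoise_le hP hη (hF _ (hmem x)) (hD _ (hmem x))) j).trans_eq ?_)
  ring

theorem integral_fieldNoise_add_le (hX : IsMarkovChain μ X P) (hP : P ∈ rowStochastic ℝ E)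
    (hη : IsStationary P η) (hmix : MixesGeometrically P η m r) (hcl : IsClosed Θ)
    (hconv : Convex ℝ Θ) (hw₀ : w₀ ∈ Θ) (hα : 0 ≤ α) (hF : ∀ w ∈ Θ, ∀ x y, ‖g x y w‖ ≤ F)
    (hL : ∀ x y, LipschitzOnWith L (g x y) Θ) (hD : ∀ w ∈ Θ, ‖w - v‖ ≤ D) (n j : ℕ) :
    ∫ ω, fieldNoise P η g v (X (n + j) ω) (X (n + j + 1) ω)
        (projIterate Θ α g w₀ (X · ω) (n + j)) ∂μ ≤
      (2 * F + 2 * L * D) * (α * F * j) + 4 * F * D * (m * r ^ j) := by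
  have hmem (x : ℕ → E) (k : ℕ) : projIterate Θ α g w₀ x k ∈ Θ := projIterate_mem hcl hw₀ x k
  obtain ⟨e⟩ := hη.nonempty
  have hF0 : 0 ≤ F := (norm_nonneg _).trans (hF w₀ hw₀ e e)
  have hD0 : 0 ≤ D := (norm_nonneg _).trans (hD w₀ hw₀)
  have hrewind (ω : Ω) : fieldNoise P η g v (X (n + j) ω) (X (n + j + 1) ω)
        (projIterate Θ α g w₀ (X · ω) (n + j)) ≤ (2 * F + 2 * L * D) * (α * F * j) +
      fieldNoise P η g v (X (n + j) ω) (X (n + j + 1) ω) (projIterate Θ α g w₀ (X · ω) n) := by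
    rw [← sub_le_iff_le_add]
    refine (fieldNoise_sub_fieldNoise_le hP hη hF hL hD (hmem _ _) (hmem _ _) _ _).trans ?_
    gcongr
    exact norm_projIterate_add_sub_le hcl hconv hw₀ hα hF _ n j
  have hdelayed := integrable_fieldNoise (η := η) (g := g) (Θ := Θ) (α := α) (w₀ := w₀) (v := v)
    hX n j
  refine (integral_mono (integrable_fieldNoise hX (n + j) 0)
    ((integrable_const _).add hdelayed) hrewind).trans ?_
  rw [integral_add' (integrable_const _) hdelayed, integral_const, probReal_univ, one_smul]
  gcongr
  exact integral_fieldNoise_delayed_le hX hP hη hmix hcl hw₀ hF hD n j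

theorem integral_fieldNoise_le (hX : IsMarkovChain μ X P) (hP : P ∈ rowStochastic ℝ E)
    (hη : IsStationary P η) (hmix : MixesGeometrically P η m r) (hr : 0 ≤ r) (hcl : IsClosed Θ)
    (hconv : Convex ℝ Θ) (hw₀ : w₀ ∈ Θ) (hα : 0 ≤ α) (hF : ∀ w ∈ Θ, ∀ x y, ‖g x y w‖ ≤ F)
    (hL : ∀ x y, LipschitzOnWith L (g x y) Θ) (hD : ∀ w ∈ Θ, ‖w - v‖ ≤ D) {τ : ℕ}
    (hτ : m * r ^ τ ≤ α) (k : ℕ) :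
    ∫ ω, fieldNoise P η g v (X k ω) (X (k + 1) ω) (projIterate Θ α g w₀ (X · ω) k) ∂μ ≤
      α * ((2 * F + 2 * L * D) * F * τ + 4 * F * D) + 4 * F * D * m * r ^ k := by
  obtain ⟨e⟩ := hη.nonempty
  have hm : 0 ≤ m := hmix.nonneg e
  have hF0 : 0 ≤ F := (norm_nonneg _).trans (hF w₀ hw₀ e e)
  have hD0 : 0 ≤ D := (norm_nonneg _).trans (hD w₀ hw₀)
  have hbound (n j : ℕ) := integral_fieldNoise_add_le hX hP hη hmix hcl hconv hw₀ hα hF hL hD n j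
  rcases le_total τ k with hk | hk
  · obtain ⟨n, rfl⟩ := Nat.exists_eq_add_of_le' hk
    calc _ ≤ (2 * F + 2 * L * D) * (α * F * τ) + 4 * F * D * (m * r ^ τ) := hbound n τ
      _ ≤ (2 * F + 2 * L * D) * (α * F * τ) + 4 * F * D * α := by gcongr
      _ ≤ _ := by
        have : 0 ≤ 4 * F * D * m * r ^ (n + τ) := by positivity
        linarith
  · have h0 := hbound 0 k
    simp only [zero_add] at h0
    calc _ ≤ (2 * F + 2 * L * D) * (α * F * k) + 4 * F * D * (m * r ^ k) := h0
      _ ≤ (2 * F + 2 * L * D) * (α * F * τ) + 4 * F * D * (m * r ^ k) := by gcongr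
      _ ≤ _ := by
        have : 0 ≤ α * (4 * F * D) := by positivity
        linarith

theorem sum_integral_fieldNoise_le (hX : IsMarkovChain μ X P) (hP : P ∈ rowStochastic ℝ E)
    (hη : IsStationary P η) (hmix : MixesGeometrically P η m r) (hr0 : 0 ≤ r) (hr1 : r < 1)
    (hcl : IsClosed Θ) (hconv : Convex ℝ Θ) (hw₀ : w₀ ∈ Θ) (hα : 0 ≤ α)
    (hF : ∀ w ∈ Θ, ∀ x y, ‖g x y w‖ ≤ F) (hL : ∀ x y, LipschitzOnWith L (g x y) Θ)
    (hD : ∀ w ∈ Θ, ‖w - v‖ ≤ D) {τ : ℕ} (hτ : m * r ^ τ ≤ α) (K : ℕ) :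
    ∑ k ∈ Finset.range K,
        ∫ ω, fieldNoise P η g v (X k ω) (X (k + 1) ω) (projIterate Θ α g w₀ (X · ω) k) ∂μ ≤
      K * α * ((2 * F + 2 * L * D) * F * τ + 4 * F * D) + 4 * F * D * m / (1 - r) := by
  obtain ⟨e⟩ := hη.nonempty
  have hm : 0 ≤ m := hmix.nonneg e
  have hF0 : 0 ≤ F := (norm_nonneg _).trans (hF w₀ hw₀ e e)
  have hD0 : 0 ≤ D := (norm_nonneg _).trans (hD w₀ hw₀)
  calc _ ≤ ∑ k ∈ Finset.range K,
        (α * ((2 * F + 2 * L * D) * F * τ + 4 * F * D) + 4 * F * D * m * r ^ k) :=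
        Finset.sum_le_sum fun k _ =>
          integral_fieldNoise_le hX hP hη hmix hr0 hcl hconv hw₀ hα hF hL hD hτ k
    _ = K * α * ((2 * F + 2 * L * D) * F * τ + 4 * F * D) +
        4 * F * D * m * ∑ k ∈ Finset.range K, r ^ k := by
        rw [Finset.sum_add_distrib, Finset.sum_const, Finset.card_range, nsmul_eq_mul,
          ← Finset.mul_sum, ← mul_assoc]
    _ ≤ _ := by
        rw [← mul_one_div (4 * F * D * m)]
        gcongr
        exact sum_range_pow_le hr0 hr1 K

theorem integral_sum_inner_meanField_le (hX : IsMarkovChain μ X P) (hP : P ∈ rowStochastic ℝ E)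
    (hη : IsStationary P η) (hmix : MixesGeometrically P η m r) (hr0 : 0 ≤ r) (hr1 : r < 1)
    (hcl : IsClosed Θ) (hconv : Convex ℝ Θ) (hw₀ : w₀ ∈ Θ) (hv : v ∈ Θ) (hα : 0 < α)
    (hF : ∀ w ∈ Θ, ∀ x y, ‖g x y w‖ ≤ F) (hL : ∀ x y, LipschitzOnWith L (g x y) Θ)
    (hD : ∀ w ∈ Θ, ‖w - v‖ ≤ D) {τ : ℕ} (hτ : m * r ^ τ ≤ α) (K : ℕ) :
    ∫ ω, ∑ k ∈ Finset.range K, ⟪meanField P η g (projIterate Θ α g w₀ (X · ω) k),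
        v - projIterate Θ α g w₀ (X · ω) k⟫_ℝ ∂μ ≤
      ‖v - w₀‖ ^ 2 / (2 * α) + K * α * (F ^ 2 / 2 + (2 * F + 2 * L * D) * F * τ + 4 * F * D) +
        4 * F * D * m / (1 - r) := by
  have hnoise (k : ℕ) : Integrable (fun ω => fieldNoise P η g v (X k ω) (X (k + 1) ω)
      (projIterate Θ α g w₀ (X · ω) k)) μ := integrable_fieldNoise hX k 0
  have hpath (ω : Ω) : ∑ k ∈ Finset.range K, ⟪meanField P η g (projIterate Θ α g w₀ (X · ω) k),
        v - projIterate Θ α g w₀ (X · ω) k⟫_ℝ ≤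
      ‖v - w₀‖ ^ 2 / (2 * α) + K * α * F ^ 2 / 2 + ∑ k ∈ Finset.range K,
        fieldNoise P η g v (X k ω) (X (k + 1) ω) (projIterate Θ α g w₀ (X · ω) k) := by
    rw [← mul_le_mul_iff_right₀ (show 0 < 2 * α by positivity)]
    refine (two_mul_sum_inner_meanField_projIterate_le hcl hconv hw₀ hv hα.le hF
      (X · ω) K).trans_eq ?_
    field_simp
  have hint := integrable_finsetSum (Finset.range K) fun k _ => hnoise k
  refine (integral_mono (integrable_sum_inner_meanField hX K)
    ((integrable_const _).add hint) hpath).trans ?_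
  rw [integral_add' (integrable_const _) hint, integral_const, probReal_univ, one_smul,
    integral_finsetSum _ fun k _ => hnoise k]
  linarith [sum_integral_fieldNoise_le hX hP hη hmix hr0 hr1 hcl hconv hw₀ hα.le hF hL hD hτ K]

end ExpectedRegret

section WeightedNorm

variable {E : Type*} [Fintype E] {P : Matrix E E ℝ} {η f h : E → ℝ}

theorem sqNorm_sub_smul (η f h : E → ℝ) (t : ℝ) :
    sqNorm η (f - t • h) =
      sqNorm η h * (t * t) + -2 * (∑ x, η x * (f x * h x)) * t + sqNorm η f := by
  simp only [sqNorm, Finset.mul_sum, Finset.sum_mul, ← Finset.sum_add_distrib, Pi.sub_apply,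
    Pi.smul_apply, smul_eq_mul]
  exact Finset.sum_congr rfl fun x _ => by ring

theorem sum_mul_mul_eq_zero_of_forall_sqNorm_le
    (hmin : ∀ t : ℝ, sqNorm η f ≤ sqNorm η (f - t • h)) : ∑ x, η x * (f x * h x) = 0 := by
  have hdiscrim := discrim_le_zero (a := sqNorm η h) (b := -2 * ∑ x, η x * (f x * h x)) (c := 0)
    fun t => by linarith [hmin t, sqNorm_sub_smul η f h t]
  rw [discrim] at hdiscrim
  exact pow_eq_zero_iff two_ne_zero |>.1 (by nlinarith)

theorem mul_sqNorm_average_le (hη : ∀ x, 0 ≤ η x) (f : ℕ → E → ℝ) (K : ℕ) :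
    K * sqNorm η ((1 / (K : ℝ)) • ∑ k ∈ Finset.range K, f k) ≤
      ∑ k ∈ Finset.range K, sqNorm η (f k) := by
  have hpoint (x : E) : K * (1 / (K : ℝ) * ∑ k ∈ Finset.range K, f k x) ^ 2 ≤
      ∑ k ∈ Finset.range K, f k x ^ 2 := by
    rcases K.eq_zero_or_pos with rfl | hK
    · simp
    · have hsq := sq_sum_le_card_mul_sum_sq (s := Finset.range K) (f := fun k => f k x)
      rw [Finset.card_range] at hsq
      calc _ = (∑ k ∈ Finset.range K, f k x) ^ 2 / K := by field_simp
        _ ≤ _ := by rwa [div_le_iff₀' (by positivity)]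
  simp only [sqNorm]
  rw [Finset.sum_comm, Finset.mul_sum]
  refine Finset.sum_le_sum fun x _ => ?_
  rw [← Finset.mul_sum, mul_left_comm]
  simpa only [Pi.smul_apply, Finset.sum_apply, smul_eq_mul] using
    mul_le_mul_of_nonneg_left (hpoint x) (hη x)

theorem IsStationary.stationaryMean_snd (hη : IsStationary P η) (f : E → ℝ) :
    stationaryMean P η (fun _ y => f y) = ∑ x, η x * f x := by
  simp only [stationaryMean, smul_eq_mul, Finset.mul_sum, ← mul_assoc]
  rw [Finset.sum_comm]
  simp only [← Finset.sum_mul, hη.stationary]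

variable [DecidableEq E]

theorem stationaryMean_fst (hP : P ∈ rowStochastic ℝ E) (η f : E → ℝ) :
    stationaryMean P η (fun x _ => f x) = ∑ x, η x * f x := by
  simp only [stationaryMean, smul_eq_mul, ← Finset.sum_mul, sum_row_of_mem_rowStochastic hP,
    one_mul]

theorem IsStationary.sum_mul_mulVec_mul_le_sqNorm (hη : IsStationary P η)
    (hP : P ∈ rowStochastic ℝ E) (f : E → ℝ) :
    ∑ x, η x * ((P *ᵥ f) x * f x) ≤ sqNorm η f := by
  have hfst := stationaryMean_fst hP η fun x => f x ^ 2
  have hsnd := hη.stationaryMean_snd fun x => f x ^ 2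
  have hamgm : 2 * ∑ x, η x * ((P *ᵥ f) x * f x) ≤
      stationaryMean P η (fun x _ => f x ^ 2) + stationaryMean P η (fun _ y => f y ^ 2) := by
    simp only [stationaryMean, mulVec, dotProduct, smul_eq_mul, ← Finset.sum_add_distrib,
      ← mul_add, Finset.mul_sum, Finset.sum_mul]
    refine Finset.sum_le_sum fun x _ => Finset.sum_le_sum fun y _ => ?_
    have hw : 0 ≤ η x * P x y := mul_nonneg (hη.nonneg x) (nonneg_of_mem_rowStochastic hP)
    linarith [mul_le_mul_of_nonneg_left (two_mul_le_add_sq (f x) (f y)) hw]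
  rw [hfst, hsnd] at hamgm
  rw [sqNorm]
  linarith

end WeightedNorm

section TemporalDifference

variable {S A : Type*} [Fintype S] {N : ℕ} {M : MDP S A} {γ Rmax R α m r : ℝ} {η : S × A → ℝ}
  {φ : S × A → EuclideanSpace ℝ (Fin N)} {Θ : Set (EuclideanSpace ℝ (Fin N))}
  {v w w₀ : EuclideanSpace ℝ (Fin N)}

theorem linQ_sub {E : Type*} (φ : E → EuclideanSpace ℝ (Fin N)) (v w : EuclideanSpace ℝ (Fin N)) :
    linQ φ (v - w) = linQ φ v - linQ φ w :=
  funext fun _ => inner_sub_left _ _ _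

theorem abs_linQ_le {E : Type*} {φ : E → EuclideanSpace ℝ (Fin N)} (hφ : ∀ x, ‖φ x‖ ≤ 1)
    (w : EuclideanSpace ℝ (Fin N)) (x : E) : |linQ φ w x| ≤ ‖w‖ :=
  (abs_real_inner_le_norm _ _).trans (mul_le_of_le_one_right (norm_nonneg _) (hφ x))

theorem linQ_sub_linQ_average {E : Type*} (φ : E → EuclideanSpace ℝ (Fin N))
    (v : EuclideanSpace ℝ (Fin N)) (w : ℕ → EuclideanSpace ℝ (Fin N)) {K : ℕ} (hK : K ≠ 0) :
    linQ φ v - linQ φ ((1 / (K : ℝ)) • ∑ k ∈ Finset.range K, w k) =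
      (1 / (K : ℝ)) • ∑ k ∈ Finset.range K, (linQ φ v - linQ φ (w k)) := by
  ext x
  simp only [Pi.sub_apply, Pi.smul_apply, Finset.sum_apply, linQ]
  simp only [real_inner_smul_left, sum_inner, Finset.sum_sub_distrib, Finset.sum_const,
    Finset.card_range, smul_eq_mul, nsmul_eq_mul]
  field_simp

theorem norm_semiGradient_le (hγ0 : 0 ≤ γ) (hγ1 : γ ≤ 1)
    (hreward : ∀ s a, |M.reward s a| ≤ Rmax) (hφ : ∀ x, ‖φ x‖ ≤ 1) (hw : ‖w‖ ≤ R) (x y : S × A) :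
    ‖semiGradient M γ φ x y w‖ ≤ Rmax + 2 * R := by
  have hx := (abs_linQ_le hφ w x).trans hw
  have hy := (abs_linQ_le hφ w y).trans hw
  have hγy : |γ * linQ φ w y| ≤ R := by
    rw [abs_mul, abs_of_nonneg hγ0]
    exact (mul_le_of_le_one_left (abs_nonneg _) hγ1).trans hy
  rw [semiGradient, norm_smul, Real.norm_eq_abs]
  refine (mul_le_of_le_one_right (abs_nonneg _) (hφ x)).trans ?_
  linarith [abs_sub (M.reward x.1 x.2 + γ * linQ φ w y) (linQ φ w x),
    abs_add_le (M.reward x.1 x.2) (γ * linQ φ w y), hreward x.1 x.2]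

theorem lipschitzWith_semiGradient (M : MDP S A) (hγ0 : 0 ≤ γ) (hγ1 : γ ≤ 1)
    (hφ : ∀ x, ‖φ x‖ ≤ 1) (x y : S × A) : LipschitzWith 2 (semiGradient M γ φ x y) := by
  refine .of_dist_le_mul fun w u => ?_
  have hdiff : semiGradient M γ φ x y w - semiGradient M γ φ x y u =
      (γ * linQ φ (w - u) y - linQ φ (w - u) x) • φ x := by
    rw [semiGradient, semiGradient, ← sub_smul, linQ_sub, Pi.sub_apply, Pi.sub_apply]
    congr 1
    ring
  have hγy : |γ * linQ φ (w - u) y| ≤ ‖w - u‖ := by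
    rw [abs_mul, abs_of_nonneg hγ0]
    exact (mul_le_of_le_one_left (abs_nonneg _) hγ1).trans (abs_linQ_le hφ _ y)
  rw [dist_eq_norm, dist_eq_norm, hdiff, norm_smul, Real.norm_eq_abs, NNReal.coe_ofNat]
  refine (mul_le_of_le_one_right (abs_nonneg _) (hφ x)).trans ?_
  linarith [abs_sub (γ * linQ φ (w - u) y) (linQ φ (w - u) x), abs_linQ_le hφ (w - u) x]

theorem tdIterate_eq_projIterate (M : MDP S A) (γ : ℝ) (φ : S × A → EuclideanSpace ℝ (Fin N))
    (Θ : Set (EuclideanSpace ℝ (Fin N))) (α : ℝ) (w₀ : EuclideanSpace ℝ (Fin N)) (x : ℕ → S × A)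
    (k : ℕ) : tdIterate M γ φ Θ α w₀ x k = projIterate Θ α (semiGradient M γ φ) w₀ x k := by
  induction k with
  | zero => rfl
  | succ k ih => rw [tdIterate, projIterate, ih]

theorem tdAverage_congr {x x' : ℕ → S × A} {K : ℕ} (h : ∀ t ≤ K, x t = x' t) :
    tdAverage M γ φ Θ α w₀ x K = tdAverage M γ φ Θ α w₀ x' K := by
  unfold tdAverage
  refine congrArg _ (Finset.sum_congr rfl fun k hk => ?_)
  rw [tdIterate_eq_projIterate, tdIterate_eq_projIterate,
    projIterate_congr fun t ht => h t (ht.trans (Finset.mem_range.1 hk).le)]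

variable [Fintype A] {π : Policy S A}

theorem chainMatrix_mem_rowStochastic [DecidableEq S] [DecidableEq A] (M : MDP S A)
    (π : Policy S A) : chainMatrix M π ∈ rowStochastic ℝ (S × A) := by
  refine mem_rowStochastic_iff_sum.2
    ⟨fun x y => mul_nonneg (M.trans_nonneg _ _ _) (π.prob_nonneg _ _), fun x => ?_⟩
  simp only [chainMatrix, of_apply, Fintype.sum_prod_type, ← Finset.mul_sum, π.prob_sum, mul_one,
    M.trans_sum]

theorem bellman_eq_add_mulVec (M : MDP S A) (π : Policy S A) (γ : ℝ) (Q : S × A → ℝ) :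
    bellman M π γ Q = (fun x => M.reward x.1 x.2) + γ • (chainMatrix M π *ᵥ Q) := by
  ext x
  simp only [bellman, Pi.add_apply, Pi.smul_apply, smul_eq_mul, mulVec, dotProduct, chainMatrix,
    of_apply, Fintype.sum_prod_type]

theorem inner_meanField_semiGradient (M : MDP S A) (π : Policy S A) (γ : ℝ) (η : S × A → ℝ)
    (φ : S × A → EuclideanSpace ℝ (Fin N)) (w d : EuclideanSpace ℝ (Fin N)) :
    ⟪meanField (chainMatrix M π) η (semiGradient M γ φ) w, d⟫_ℝ =
      ∑ x, η x * ((bellman M π γ (linQ φ w) - linQ φ w) x * linQ φ d x) := by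
  classical
  have hrow := sum_row_of_mem_rowStochastic (chainMatrix_mem_rowStochastic M π)
  rw [meanField, inner_stationaryMean]
  refine Finset.sum_congr rfl fun x _ => congrArg (η x * ·) ?_
  have hterm (y : S × A) : chainMatrix M π x y * ⟪semiGradient M γ φ x y w, d⟫_ℝ =
      (chainMatrix M π x y * (M.reward x.1 x.2 - linQ φ w x) +
        γ * (chainMatrix M π x y * linQ φ w y)) * linQ φ d x := by
    rw [semiGradient, real_inner_smul_left, real_inner_comm]
    simp only [linQ]
    ring
  simp only [smul_eq_mul, hterm, ← Finset.sum_mul, Finset.sum_add_distrib, hrow, one_mul,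
    ← Finset.mul_sum, bellman_eq_add_mulVec, Pi.sub_apply, Pi.add_apply, Pi.smul_apply, mulVec,
    dotProduct]
  ring

theorem IsProjectedBellmanSolution.inner_meanField_eq_zero
    (hv : IsProjectedBellmanSolution M π γ η φ v) (d : EuclideanSpace ℝ (Fin N)) :
    ⟪meanField (chainMatrix M π) η (semiGradient M γ φ) v, d⟫_ℝ = 0 := by
  rw [inner_meanField_semiGradient]
  refine sum_mul_mul_eq_zero_of_forall_sqNorm_le fun t => (hv (v + t • d)).trans_eq ?_
  congr 1
  ext x
  simp only [Pi.sub_apply, Pi.smul_apply, linQ, inner_add_left, real_inner_smul_left, smul_eq_mul]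
  ring

-- At the solution `v` the mean field vanishes; what remains is `⟪f - γ P f, f⟫_η`, `f = Q_v - Q_w`.
theorem IsProjectedBellmanSolution.mul_sqNorm_le_inner_meanField
    (hv : IsProjectedBellmanSolution M π γ η φ v) (hη : IsStationary (chainMatrix M π) η)
    (hγ0 : 0 ≤ γ) (w : EuclideanSpace ℝ (Fin N)) :
    (1 - γ) * sqNorm η (linQ φ v - linQ φ w) ≤
      ⟪meanField (chainMatrix M π) η (semiGradient M γ φ) w, v - w⟫_ℝ := by
  classical
  set f := linQ φ v - linQ φ w with hf
  have hcontract : ∑ x, η x * ((chainMatrix M π *ᵥ f) x * f x) ≤ sqNorm η f :=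
    hη.sum_mul_mulVec_mul_le_sqNorm (chainMatrix_mem_rowStochastic M π) f
  have hdiff : ⟪meanField (chainMatrix M π) η (semiGradient M γ φ) w, v - w⟫_ℝ -
      ⟪meanField (chainMatrix M π) η (semiGradient M γ φ) v, v - w⟫_ℝ =
        sqNorm η f - γ * ∑ x, η x * ((chainMatrix M π *ᵥ f) x * f x) := by
    rw [inner_meanField_semiGradient, inner_meanField_semiGradient, linQ_sub, ← hf, sqNorm,
      Finset.mul_sum, ← Finset.sum_sub_distrib, ← Finset.sum_sub_distrib]
    refine Finset.sum_congr rfl fun x _ => ?_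
    simp only [hf, bellman_eq_add_mulVec, mulVec_sub, Pi.sub_apply, Pi.add_apply, Pi.smul_apply,
      smul_eq_mul]
    ring
  rw [hv.inner_meanField_eq_zero, sub_zero] at hdiff
  rw [hdiff]
  linarith [mul_le_mul_of_nonneg_left hcontract hγ0]

theorem IsProjectedBellmanSolution.mul_sqNorm_tdAverage_le
    (hv : IsProjectedBellmanSolution M π γ η φ v) (hη : IsStationary (chainMatrix M π) η)
    (hγ0 : 0 ≤ γ) (hγ1 : γ ≤ 1) (x : ℕ → S × A) {K : ℕ} (hK : K ≠ 0) :
    (1 - γ) * K * sqNorm η (linQ φ v - linQ φ (tdAverage M γ φ Θ α w₀ x K)) ≤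
      ∑ k ∈ Finset.range K, ⟪meanField (chainMatrix M π) η (semiGradient M γ φ)
        (projIterate Θ α (semiGradient M γ φ) w₀ x k),
        v - projIterate Θ α (semiGradient M γ φ) w₀ x k⟫_ℝ := by
  simp only [tdAverage, linQ_sub_linQ_average φ v _ hK, tdIterate_eq_projIterate]
  refine .trans ?_ (Finset.sum_le_sum fun k _ => hv.mul_sqNorm_le_inner_meanField hη hγ0 _)
  rw [mul_assoc, ← Finset.mul_sum]
  exact mul_le_mul_of_nonneg_left (mul_sqNorm_average_le hη.nonneg _ K) (sub_nonneg.2 hγ1)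

theorem integrable_sqNorm_tdAverage {Ω : Type*} [MeasurableSpace Ω] {μ : Measure Ω}
    [IsFiniteMeasure μ] {X : ℕ → Ω → S × A} (hX : IsMarkovChain μ X (chainMatrix M π)) (K : ℕ) :
    Integrable (fun ω => sqNorm η (linQ φ v - linQ φ (tdAverage M γ φ Θ α w₀ (X · ω) K))) μ :=
  hX.integrable (n := K) (f := fun x => sqNorm η (linQ φ v - linQ φ (tdAverage M γ φ Θ α w₀ x K)))
    fun x x' h => by simp only [tdAverage_congr h]

theorem IsProjectedBellmanSolution.integral_sqNorm_tdAverage_le [DecidableEq S] [DecidableEq A]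
    {Ω : Type*} [MeasurableSpace Ω] {μ : Measure Ω} [IsProbabilityMeasure μ] {X : ℕ → Ω → S × A}
    (hv : IsProjectedBellmanSolution M π γ η φ v) (hη : IsStationary (chainMatrix M π) η)
    (hX : IsMarkovChain μ X (chainMatrix M π)) (hγ0 : 0 ≤ γ) (hγ1 : γ < 1)
    (hreward : ∀ s a, |M.reward s a| ≤ Rmax) (hr0 : 0 ≤ r) (hr1 : r < 1)
    (hmix : MixesGeometrically (chainMatrix M π) η m r) (hφ : ∀ x, ‖φ x‖ ≤ 1)
    (hcl : IsClosed Θ) (hconv : Convex ℝ Θ) (hΘ : ∀ w ∈ Θ, ‖w‖ ≤ R) (hvΘ : v ∈ Θ)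
    (hw₀ : w₀ ∈ Θ) (hα : 0 < α) {K : ℕ} (hK : K ≠ 0) {F : ℝ} (hF : F = Rmax + 2 * R) :
    ∫ ω, sqNorm η (linQ φ v - linQ φ (tdAverage M γ φ Θ α w₀ (X · ω) K)) ∂μ ≤
      (‖v - w₀‖ ^ 2 / α + K * α * F ^ 2 * (9 + 12 * mixingTime m r α)) / (2 * (1 - γ) * K) +
        4 * F ^ 2 * m / ((1 - r) * (1 - γ) * K) := by
  have hγ : 0 < 1 - γ := sub_pos.2 hγ1
  have hr : 0 < 1 - r := sub_pos.2 hr1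
  obtain ⟨e⟩ := hη.nonempty
  have hRmax : 0 ≤ Rmax := (abs_nonneg _).trans (hreward e.1 e.2)
  have hgF : ∀ w ∈ Θ, ∀ x y, ‖semiGradient M γ φ x y w‖ ≤ F := fun w hw x y =>
    hF ▸ norm_semiGradient_le hγ0 hγ1.le hreward hφ (hΘ w hw) x y
  have hdiam : ∀ w ∈ Θ, ‖w - v‖ ≤ F := fun w hw => by
    linarith [norm_sub_le w v, hΘ w hw, hΘ v hvΘ]
  have hregret := integral_sum_inner_meanField_le hX (chainMatrix_mem_rowStochastic M π) hη hmix
    hr0 hr1 hcl hconv hw₀ hvΘ hα hgF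
    (fun x y => (lipschitzWith_semiGradient M hγ0 hγ1.le hφ x y).lipschitzOnWith) hdiam
    (mul_pow_mixingTime_le hr0 hr1 m hα) K
  have hdrift : ∫ ω, (1 - γ) * K *
        sqNorm η (linQ φ v - linQ φ (tdAverage M γ φ Θ α w₀ (X · ω) K)) ∂μ ≤ _ :=
    integral_mono ((integrable_sqNorm_tdAverage hX K).const_mul ((1 - γ) * K))
      (integrable_sum_inner_meanField hX K)
      fun ω => hv.mul_sqNorm_tdAverage_le hη hγ0 hγ1.le (X · ω) hK
  rw [integral_const_mul, ← le_div_iff₀' (by positivity)] at hdrift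
  refine (hdrift.trans (div_le_div_of_nonneg_right hregret (by positivity))).trans_eq ?_
  rw [NNReal.coe_ofNat]
  field_simp
  ring

end TemporalDifference

end TDZero

theorem theorem4_general {S A : Type*} [Fintype S] [DecidableEq S] [Fintype A] [DecidableEq A]
    (M : TDZero.MDP S A) (π : TDZero.Policy S A)
    (γ : ℝ) (hγ0 : 0 ≤ γ) (hγ1 : γ < 1)
    (Rmax : ℝ) (hreward : ∀ s a, |M.reward s a| ≤ Rmax)
    (η : S × A → ℝ) (hη : TDZero.IsStationary (TDZero.chainMatrix M π) η)
    (m r : ℝ) (hr0 : 0 ≤ r) (hr1 : r < 1)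
    (hmix : TDZero.MixesGeometrically (TDZero.chainMatrix M π) η m r)
    (N : ℕ) (φ : S × A → EuclideanSpace ℝ (Fin N))
    (hφnorm : ∀ x, ‖φ x‖ ^ 2 ≤ 1)
    (R : ℝ)
    (Θ : Set (EuclideanSpace ℝ (Fin N))) (hΘconv : Convex ℝ Θ) (hΘclosed : IsClosed Θ)
    (hΘR : ∀ w ∈ Θ, ‖w‖ ≤ R)
    (wstar : EuclideanSpace ℝ (Fin N)) (hwstar : wstar ∈ Θ)
    (hsol : TDZero.IsProjectedBellmanSolution M π γ η φ wstar)
    (w₀ : EuclideanSpace ℝ (Fin N)) (hw₀ : w₀ ∈ Θ)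
    {Ω : Type*} [MeasurableSpace Ω] (μ : MeasureTheory.Measure Ω)
    [MeasureTheory.IsProbabilityMeasure μ]
    (X : ℕ → Ω → S × A) (hX : TDZero.IsMarkovChain μ X (TDZero.chainMatrix M π))
    (K : ℕ) (hK : 1 ≤ K) (F : ℝ) (hF : F = Rmax + 2 * R) :
    MeasureTheory.Integrable
      (fun ω => TDZero.sqNorm η (TDZero.linQ φ wstar - TDZero.linQ φ
        (TDZero.tdAverage M γ φ Θ (1 / Real.sqrt K) w₀ (fun t => X t ω) K))) μ ∧
    ∫ ω, TDZero.sqNorm η (TDZero.linQ φ wstar - TDZero.linQ φ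
        (TDZero.tdAverage M γ φ Θ (1 / Real.sqrt K) w₀ (fun t => X t ω) K)) ∂μ ≤
      (‖wstar - w₀‖ ^ 2 +
          F ^ 2 * (9 + 12 * (TDZero.mixingTime m r (1 / Real.sqrt K) : ℝ))) /
          (2 * (1 - γ) * Real.sqrt K) +
        4 * F ^ 2 * m / ((1 - r) * (1 - γ) * K) := by
  have hK0 : K ≠ 0 := Nat.one_le_iff_ne_zero.1 hK
  have hα : 0 < 1 / Real.sqrt K := by positivity
  have hγ : 0 < 1 - γ := sub_pos.2 hγ1
  have hφ : ∀ x, ‖φ x‖ ≤ 1 := fun x => (sq_le_one_iff₀ (norm_nonneg _)).1 (hφnorm x)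
  refine ⟨TDZero.integrable_sqNorm_tdAverage hX K,
    (hsol.integral_sqNorm_tdAverage_le hη hX hγ0 hγ1 hreward hr0 hr1 hmix hφ hΘclosed hΘconv hΘR
      hwstar hw₀ hα hK0 hF).trans_eq ?_⟩
  have hsq : Real.sqrt K ^ 2 = K := Real.sq_sqrt K.cast_nonneg
  congr 1
  field_simp
  rw [hsq]
  ring

theorem theorem4 {S A : Type*} [Fintype S] [DecidableEq S] [Fintype A] [DecidableEq A]
    (M : TDZero.MDP S A) (π : TDZero.Policy S A)
    (γ : ℝ) (hγ0 : 0 < γ) (hγ1 : γ < 1)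
    (Rmax : ℝ) (hRmax : 0 < Rmax) (hreward : ∀ s a, |M.reward s a| ≤ Rmax)
    (hπ : ∀ s a, 0 < π.prob s a)
    (herg : TDZero.IsErgodic (TDZero.chainMatrix M π))
    (η : S × A → ℝ) (hη : TDZero.IsStationary (TDZero.chainMatrix M π) η)
    (m r : ℝ) (hm : 0 < m) (hr0 : 0 < r) (hr1 : r < 1)
    (hmix : TDZero.MixesGeometrically (TDZero.chainMatrix M π) η m r)
    (N : ℕ) (φ : S × A → EuclideanSpace ℝ (Fin N))
    (hφrank : LinearIndependent ℝ (fun (n : Fin N) (x : S × A) => φ x n))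
    (hφnorm : ∀ x, ‖φ x‖ ^ 2 ≤ 1)
    (R : ℝ) (hR : 0 < R)
    (Θ : Set (EuclideanSpace ℝ (Fin N))) (hΘconv : Convex ℝ Θ) (hΘclosed : IsClosed Θ)
    (hΘR : ∀ w ∈ Θ, ‖w‖ ≤ R)
    (wstar : EuclideanSpace ℝ (Fin N)) (hwstar : wstar ∈ Θ)
    (hsol : TDZero.IsProjectedBellmanSolution M π γ η φ wstar)
    (w₀ : EuclideanSpace ℝ (Fin N)) (hw₀ : w₀ ∈ Θ)
    {Ω : Type*} [MeasurableSpace Ω] (μ : MeasureTheory.Measure Ω)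
    [MeasureTheory.IsProbabilityMeasure μ]
    (X : ℕ → Ω → S × A) (hX : TDZero.IsMarkovChain μ X (TDZero.chainMatrix M π))
    (K : ℕ) (hK : 1 ≤ K) (F : ℝ) (hF : F = Rmax + 2 * R) :
    MeasureTheory.Integrable
      (fun ω => TDZero.sqNorm η (TDZero.linQ φ wstar - TDZero.linQ φ
        (TDZero.tdAverage M γ φ Θ (1 / Real.sqrt K) w₀ (fun t => X t ω) K))) μ ∧
    ∫ ω, TDZero.sqNorm η (TDZero.linQ φ wstar - TDZero.linQ φ
        (TDZero.tdAverage M γ φ Θ (1 / Real.sqrt K) w₀ (fun t => X t ω) K)) ∂μ ≤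
      (‖wstar - w₀‖ ^ 2 +
          F ^ 2 * (17 + 12 * (TDZero.mixingTime m r (1 / Real.sqrt K) : ℝ))) /
          (2 * (1 - γ) * Real.sqrt K) +
        10 * F ^ 2 * m / ((1 - r) * (1 - γ) * K) := by
  have := sub_pos.2 hγ1
  have := sub_pos.2 hr1
  refine (theorem4_general M π γ hγ0.le hγ1 Rmax hreward η hη m r hr0.le hr1 hmix N φ hφnorm R Θ
    hΘconv hΘclosed hΘR wstar hwstar hsol w₀ hw₀ μ X hX K hK F hF).imp_right fun h => h.trans ?_
  gcongr <;> norm_num
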